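/- Let $\Gamma_1$ be a triangle with an upmost, a leftmost and a rightmost vertex, whose edges leftmost–upmost, leftmost–rightmost and upmost–rightmost are labelled $a$, $b$ and $c$ respectively. For $n\ge 1$ let $\Gamma_{n+1}$ be the labelled graph obtained by placing a copy of $\Gamma_n$ at each of the three corners of an equilateral triangle of twice the side length, the copy at a given corner being reflected in the bisectrix of the angle at that corner; vertices of the copies at the same position are identified, and labels are kept. The outmost vertices of $\Gamma_{n+1}$ are the three corners of the big triangle. (These are the Sierpiński graphs with the ``Schreier'' labelling.) Give each edge its label $a$, $b$ or $c$ as its weight, and let the weight of a subgraph be the product of the weights of its edges. A spanning $k$-forest of a graph is an acyclic subgraph with exactly $k$ connected components that contains all the vertices; a spanning tree is a spanning $1$-forest. For $n\ge 1$ let - $T_n(a,b,c)$ be the sum of the weights of the spanning trees of $\Gamma_n$; - $U_n(a,b,c)$ be the sum of the weights of the spanning $2$-forests of $\Gamma_n$ in which the leftmost and the rightmost vertices are in the same component and the upmost vertex is in the other one; and let $R_n(a,b,c)$ (respectively $L_n(a,b,c)$) be the analogous sum for the spanning $2$-forests in which the rightmost (respectively leftmost) vertex is not in the component containing the other two outmost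 vertices; - $Q_n(a,b,c)$ be the sum of the weights of the spanning $3$-forests of $\Gamma_n$ in which the three outmost vertices are in three different components. Then, as identities between polynomials in $a,b,c$ (equivalently, for all elements $a,b,c$ of any commutative semiring), for each $n\ge 1$ $$T_{n+1}=2T_n^2(U_n+R_n+L_n),$$ $$U_{n+1}=T_n\left(3L_nR_n+U_nR_n+U_nL_n+2U_n^2\right)+T_n^2Q_n,$$ $$R_{n+1}=T_n\left(3U_nL_n+U_nR_n+R_nL_n+2R_n^2\right)+T_n^2Q_n,$$ $$L_{n+1}=T_n\left(3U_nR_n+L_nU_n+R_nL_n+2L_n^2\right)+T_n^2Q_n,$$ $$Q_{n+1}=4T_nQ_n(U_n+R_n+L_n)+2\left(U_n^2(L_n+R_n)+R_n^2(U_n+L_n)+L_n^2(R_n+U_n)\right)+2U_nR_nL_n,$$ with initial values $$T_1=ab+ac+bc,\qquad U_1=b,\qquad R_1=a,\qquad L_1=c,\qquad Q_1=1.$$ -/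

import Mathlib

/-- The three edge labels. -/
inductive Label
  | a | b | c
  deriving DecidableEq

instance : Fintype Label where
  elems := {.a, .b, .c}
  complete x := by cases x <;> simp

/-- The three outmost (corner) positions of an equilateral triangle:
upmost, leftmost, rightmost. -/
inductive Corner
  | up | left | right
  deriving DecidableEq

instance : Fintype Corner where
  elems := {.up, .left, .right}
  complete x := by cases x <;> simp

/-- The symmetry of the triangle given by the reflection in the bisectrix of the angle at the
corner `k`: it fixes `k` and exchanges the other two corners. -/
def Corner.reflect : Corner → Corner → Corner
  | .up, .up => .up
  | .up, .left => .right
  | .up, .right => .left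
  | .left, .left => .left
  | .left, .up => .right
  | .left, .right => .up
  | .right, .right => .right
  | .right, .up => .left
  | .right, .left => .up

/-- Points of the triangular lattice. `x : Point` with coordinate sum `N` is the point
with barycentric coordinates `x k / N` in the equilateral triangle of side length `N`; thus the
corner `k` of that triangle has `k`-th coordinate `N` and the other coordinates `0`. -/
abbrev Point := Corner → ℕ

/-- The corner `k` of the triangle of side length `N`. -/
def cornerPoint (N : ℕ) (k : Corner) : Point := Pi.single k N

/-- The isometry which takes the triangle of side length `N`, reflects it in the bisectrix
of its angle at the corner `k`, and moves it to the corner `k` of the triangle of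
side length `2 * N`. -/
def placeCopy (N : ℕ) (k : Corner) (x : Point) : Point :=
  fun i => x (k.reflect i) + cornerPoint N k i

/-- A finite graph drawn on lattice points in an equilateral triangle of side length `side`,
with edges labelled by `a`, `b`, `c` and with three distinguished outmost vertices.
(Multiple edges are not excluded by the type.) -/
structure TriangleGraph where
  side : ℕ
  verts : Set Point
  Edge : Type
  fintypeEdge : Fintype Edge
  ends : Edge → Sym2 verts
  label : Edge → Label
  outmost : Corner → verts

namespace TriangleGraph

attribute [instance] fintypeEdge

/-- The elementary triangle: the left side is labelled `a`, the horizontal side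
is labelled `b` and the right side is labelled `c`. -/
def triangle : TriangleGraph where
  side := 1
  verts := Set.range (cornerPoint 1)
  Edge := Label
  fintypeEdge := inferInstance
  ends
    | .a => s(⟨cornerPoint 1 .left, ⟨_, rfl⟩⟩, ⟨cornerPoint 1 .up, ⟨_, rfl⟩⟩)
    | .b => s(⟨cornerPoint 1 .left, ⟨_, rfl⟩⟩, ⟨cornerPoint 1 .right, ⟨_, rfl⟩⟩)
    | .c => s(⟨cornerPoint 1 .up, ⟨_, rfl⟩⟩, ⟨cornerPoint 1 .right, ⟨_, rfl⟩⟩)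
  label := id
  outmost k := ⟨cornerPoint 1 k, ⟨k, rfl⟩⟩

variable (G : TriangleGraph)

/-- The vertices of the union of the three reflected copies of `G`. -/
def gluedVerts : Set Point := ⋃ k, placeCopy G.side k '' G.verts

/-- The inclusion of the vertices of the reflected copy of `G` placed at the corner `k`. -/
def copyVert (k : Corner) (x : G.verts) : G.gluedVerts :=
  ⟨placeCopy G.side k x, Set.mem_iUnion.2 ⟨k, x, x.2, rfl⟩⟩

/-- The union of three copies of `G` inside a triangle of double side length, the copy at each
corner being reflected in the bisectrix of the angle at that corner. Vertices at
the same position are identified, labels are kept. -/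
def glue : TriangleGraph where
  side := 2 * G.side
  verts := G.gluedVerts
  Edge := Corner × G.Edge
  fintypeEdge := inferInstance
  ends e := (G.ends e.2).map (G.copyVert e.1)
  label e := G.label e.2
  outmost k := G.copyVert k (G.outmost k)

variable {G}

/-- The spanning subgraph of `G` with edge set `F`. -/
def spanning (F : Finset G.Edge) : SimpleGraph G.verts :=
  SimpleGraph.fromEdgeSet (G.ends '' F)

/-- `F` is the edge set of a spanning `k`-forest of `G`: the spanning subgraph with edge
set `F` has no cycle (hence no loop and no pair of parallel edges) and exactly
`k` connected components. A spanning tree is a spanning `1`-forest. -/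
def IsSpanningForest (k : ℕ) (F : Finset G.Edge) : Prop :=
  (∀ e ∈ F, ¬ (G.ends e).IsDiag) ∧ Set.InjOn G.ends F ∧ (spanning F).IsAcyclic ∧
    Nat.card (spanning F).ConnectedComponent = k

/-- The outmost vertices `i` and `j` lie in the same connected component of the
spanning subgraph with edge set `F`. -/
def Joined (F : Finset G.Edge) (i j : Corner) : Prop :=
  (spanning F).Reachable (G.outmost i) (G.outmost j)

variable {R : Type*} [CommSemiring R]

/-- The weight of a set of edges: the product of the weights of the labels of its edges. -/
def weight (w : Label → R) (F : Finset G.Edge) : R := ∏ e ∈ F, w (G.label e)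

variable (G)

open Classical in
/-- The weighted generating function of the edge sets satisfying `P`. -/
noncomputable def genFun (w : Label → R) (P : Finset G.Edge → Prop) : R :=
  ∑ F : Finset G.Edge with P F, weight w F

/-- Weighted generating function of the spanning trees. -/
noncomputable def treeGF (w : Label → R) : R :=
  G.genFun w fun F => IsSpanningForest 1 F

/-- Weighted generating function of the spanning `2`-forests in which the outmost vertex `k` is
not in the component that contains the other two outmost vertices. -/
noncomputable def twoForestGF (w : Label → R) (k : Corner) : R :=
  G.genFun w fun F => IsSpanningForest 2 F ∧
    ∀ i j, i ≠ k → j ≠ k → Joined F i j ∧ ¬ Joined F i k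

/-- Weighted generating function of the spanning `3`-forests in which the three outmost vertices
are in three different components. -/
noncomputable def threeForestGF (w : Label → R) : R :=
  G.genFun w fun F => IsSpanningForest 3 F ∧ ∀ i j, i ≠ j → ¬ Joined F i j

end TriangleGraph

/-- The Sierpiński graph `Γ_n`, `n ≥ 1`, with the Schreier labelling: `Γ_1` is the elementary
triangle, and `Γ_{n+1}` is glued from three reflected copies of `Γ_n`. -/
def schreierGraph (n : ℕ) : TriangleGraph := TriangleGraph.glue^[n - 1] TriangleGraph.triangle

section Functions

variable {R : Type*} [CommSemiring R]

/-- The weights `a`, `b`, `c` of the three labels. -/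
def labelWeight (a b c : R) : Label → R
  | .a => a
  | .b => b
  | .c => c

/-- `T_n(a,b,c)`: spanning trees of `Γ_n`. -/
noncomputable def schreierT (n : ℕ) (a b c : R) : R :=
  (schreierGraph n).treeGF (labelWeight a b c)

/-- `U_n(a,b,c)`: spanning `2`-forests of `Γ_n` with the upmost vertex separated from the component
of the leftmost and rightmost vertices. -/
noncomputable def schreierU (n : ℕ) (a b c : R) : R :=
  (schreierGraph n).twoForestGF (labelWeight a b c) .up

/-- `R_n(a,b,c)`: the same with the rightmost vertex separated. -/
noncomputable def schreierR (n : ℕ) (a b c : R) : R :=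
  (schreierGraph n).twoForestGF (labelWeight a b c) .right

/-- `L_n(a,b,c)`: the same with the leftmost vertex separated. -/
noncomputable def schreierL (n : ℕ) (a b c : R) : R :=
  (schreierGraph n).twoForestGF (labelWeight a b c) .left

/-- `Q_n(a,b,c)`: spanning `3`-forests of `Γ_n` separating the three outmost vertices. -/
noncomputable def schreierQ (n : ℕ) (a b c : R) : R :=
  (schreierGraph n).threeForestGF (labelWeight a b c)

end Functions

/-! An edge set of the glued graph is a triple of edge sets, one for each copy, and copies meet only
in the three midpoints. What a copy contributes to connectivity is therefore the partition of its
corners into components, a `Pattern`. The forests counted by T, U, R, L, Q are exactly those in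
which every component contains an outmost vertex, sorted by pattern. Acyclicity is handled by
counting: an edge set with k components is a forest iff it has |V| - k edges
(`isSpanningForest_iff`). The glued graph has 3|V| - 3 vertices, so three such forests unite to one
of pattern `p` iff their patterns connect the corners as `p` prescribes and have `p.parts + 3`
blocks in total. Conversely, every such forest restricts to such forests on the copies, since the
inequalities |V| ≤ edges + components on the copies must then all be equalities
(`isPatternForest_assemble`). Hence each generating function of the glued graph is a sum of products
over the admissible triples of patterns (`patternGF_glue`). There are 125 triples, and enumerating
the admissible ones gives the recursion. -/

namespace SimpleGraph

/-! ### Edges, components and acyclicity in finite graphs. -/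

variable {V : Type*} {G : SimpleGraph V}

theorem reachable_sup_edge_iff {u v x y : V} (huv : u ≠ v) :
    (G ⊔ edge u v).Reachable x y ↔ G.Reachable x y ∨ (G.Reachable x u ∧ G.Reachable v y) ∨
      (G.Reachable x v ∧ G.Reachable u y) := by
  have hadj : (G ⊔ edge u v).Adj u v := by simp [sup_adj, edge_adj, huv]
  constructor
  · rw [reachable_iff_reflTransGen]
    intro h
    induction h with
    | refl => exact Or.inl .rfl
    | tail _ h ih =>
      rw [sup_adj, edge_adj] at h
      rcases h with h | ⟨⟨rfl, rfl⟩ | ⟨rfl, rfl⟩, -⟩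
      · have h := h.reachable
        rcases ih with ih | ih | ih
        · exact Or.inl (ih.trans h)
        · exact Or.inr (Or.inl ⟨ih.1, ih.2.trans h⟩)
        · exact Or.inr (Or.inr ⟨ih.1, ih.2.trans h⟩)
      · rcases ih with ih | ih | ih
        · exact Or.inr (Or.inl ⟨ih, .rfl⟩)
        · exact Or.inr (Or.inl ⟨ih.1, .rfl⟩)
        · exact Or.inl ih.1
      · rcases ih with ih | ih | ih
        · exact Or.inr (Or.inr ⟨ih, .rfl⟩)
        · exact Or.inl ih.1
        · exact Or.inr (Or.inr ⟨ih.1, .rfl⟩)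
  · have mono {a b : V} (h : G.Reachable a b) : (G ⊔ edge u v).Reachable a b := h.mono le_sup_left
    rintro (h | h | h)
    · exact mono h
    · exact (mono h.1).trans (hadj.reachable.trans (mono h.2))
    · exact (mono h.1).trans (hadj.symm.reachable.trans (mono h.2))

/-- The components of `G` other than that of `u` correspond bijectively to the components after
adding the edge; the merged component is represented by that of `v`. -/
theorem card_connectedComponent_sup_edge [Finite V] {u v : V} (h : ¬ G.Reachable u v) :
    Nat.card (G ⊔ edge u v).ConnectedComponent + 1 = Nat.card G.ConnectedComponent := by
  have huv : u ≠ v := fun e => h (e ▸ .rfl)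
  let f : {C : G.ConnectedComponent // C ≠ G.connectedComponentMk u} →
      (G ⊔ edge u v).ConnectedComponent := fun C => C.1.map (Hom.ofLE le_sup_left)
  have hf : Function.Bijective f := by
    constructor
    · rintro ⟨C, hC⟩ ⟨D, hD⟩ hCD
      induction C using ConnectedComponent.ind with | _ x
      induction D using ConnectedComponent.ind with | _ y
      have hCD : (G ⊔ edge u v).Reachable x y := ConnectedComponent.exact hCD
      rw [reachable_sup_edge_iff huv] at hCD
      rcases hCD with hr | hr | hr
      · exact Subtype.ext (ConnectedComponent.sound hr)
      · exact absurd (ConnectedComponent.sound hr.1) hC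
      · exact absurd (ConnectedComponent.sound hr.2.symm) hD
    · intro C
      induction C using ConnectedComponent.ind with | _ x
      by_cases hx : G.Reachable x u
      · refine ⟨⟨G.connectedComponentMk v, fun e => h (ConnectedComponent.exact e).symm⟩, ?_⟩
        exact ConnectedComponent.sound
          ((reachable_sup_edge_iff huv).2 (Or.inr (Or.inr ⟨.rfl, hx.symm⟩)))
      · exact ⟨⟨G.connectedComponentMk x, fun e => hx (ConnectedComponent.exact e)⟩, rfl⟩
  rw [← Nat.card_eq_of_bijective f hf, ← Set.ncard_add_ncard_compl {G.connectedComponentMk u},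
    Set.ncard_singleton, add_comm]
  rfl

/-- Every edge of a forest is a bridge, so deleting one creates exactly one new component; induct on
the number of edges. -/
theorem IsAcyclic.ncard_edgeSet_add_card_connectedComponent [Finite V] (hG : G.IsAcyclic) :
    G.edgeSet.ncard + Nat.card G.ConnectedComponent = Nat.card V := by
  induction hn : G.edgeSet.ncard generalizing G with
  | zero =>
    rw [Set.ncard_eq_zero, edgeSet_eq_empty] at hn
    subst hn
    rw [zero_add]
    refine (Nat.card_eq_of_bijective (connectedComponentMk ⊥) ⟨fun x y h => ?_, fun C => ?_⟩).symm
    · simpa using ConnectedComponent.exact h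
    · induction C using ConnectedComponent.ind with | _ x
      exact ⟨x, rfl⟩
  | succ n ih =>
    obtain ⟨e, he⟩ := (Set.ncard_pos (s := G.edgeSet)).1 (by omega)
    induction e with | _ u v
    have hb := isAcyclic_iff_forall_isBridge.1 hG he
    have hsup : G.deleteEdges {s(u, v)} ⊔ edge u v = G := by
      ext x y
      simp only [sup_adj, deleteEdges_adj, edge_adj, Set.mem_singleton_iff, Sym2.eq_iff]
      have : G.Adj u v := he
      have := this.symm
      have := this.ne
      grind
    have hc := card_connectedComponent_sup_edge (isBridge_iff.1 hb)
    have h1 : (G.deleteEdges {s(u, v)}).edgeSet.ncard = n := by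
      rw [edgeSet_deleteEdges, Set.ncard_sdiff_singleton_of_mem he, hn]; rfl
    have := ih (hG.anti (deleteEdges_le _)) h1
    rw [hsup] at hc
    omega

/-- Compare `G` with a maximal spanning forest, which has the same components and attains equality.
Equality for `G` leaves no edge outside this forest. -/
theorem card_le_ncard_edgeSet_add_card_connectedComponent [Finite V] (G : SimpleGraph V) :
    Nat.card V ≤ G.edgeSet.ncard + Nat.card G.ConnectedComponent ∧
      (Nat.card V = G.edgeSet.ncard + Nat.card G.ConnectedComponent → G.IsAcyclic) := by
  obtain ⟨F, hle, hF, hr⟩ := exists_isAcyclic_reachable_eq_le (G := G)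
  have hc : Nat.card F.ConnectedComponent = Nat.card G.ConnectedComponent := by
    refine Nat.card_eq_of_bijective (fun C => C.map (Hom.ofLE hle)) ⟨fun C D h => ?_, fun C => ?_⟩
    · induction C using ConnectedComponent.ind with | _ x
      induction D using ConnectedComponent.ind with | _ y
      refine ConnectedComponent.sound ?_
      rw [hr]
      exact ConnectedComponent.exact h
    · induction C using ConnectedComponent.ind with | _ x
      exact ⟨F.connectedComponentMk x, rfl⟩
  have h1 := hF.ncard_edgeSet_add_card_connectedComponent
  have hsub : F.edgeSet ⊆ G.edgeSet := edgeSet_mono hle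
  have h2 := Set.ncard_le_ncard hsub
  refine ⟨by omega, fun h => ?_⟩
  have := Set.eq_of_subset_of_ncard_le hsub (by omega)
  rwa [← edgeSet_inj.1 this]

end SimpleGraph

/-! ### Partitions of the three corners. -/

/-- The partitions of the set of corners. -/
inductive Pattern
  | joined
  | single (k : Corner)
  | discrete
  deriving DecidableEq

namespace Pattern

instance : Fintype Pattern where
  elems := {.joined, .single .up, .single .left, .single .right, .discrete}
  complete p := by
    rcases p with _ | k | _
    · simp
    · cases k <;> simp
    · simp

/-- Two corners lie in the same block of the partition. -/
def rel : Pattern → Corner → Corner → Bool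
  | joined, _, _ => true
  | single k, i, j => decide (i = j) || (decide (i ≠ k) && decide (j ≠ k))
  | discrete, i, j => decide (i = j)

/-- The number of blocks. -/
def parts : Pattern → ℕ
  | joined => 1
  | single _ => 2
  | discrete => 3

/-- A set of representatives of the blocks. -/
def reps : Pattern → Finset Corner
  | joined => {.up}
  | single .up => {.up, .left}
  | single .left => {.up, .left}
  | single .right => {.up, .right}
  | discrete => {.up, .left, .right}

theorem card_reps (p : Pattern) : p.reps.card = p.parts := by
  revert p; decide

theorem eq_of_rel_of_mem_reps (p : Pattern) :
    ∀ i ∈ p.reps, ∀ j ∈ p.reps, p.rel i j = true → i = j := by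
  revert p; decide

theorem exists_mem_reps_rel (p : Pattern) : ∀ i, ∃ j ∈ p.reps, p.rel i j = true := by
  revert p; decide

theorem rel_injective : Function.Injective rel := by
  have h : ∀ p q : Pattern, (∀ i j, p.rel i j = q.rel i j) → p = q := by decide
  exact fun p q hpq => h p q fun i j => by rw [hpq]

/-- Of the eight truth assignments to the three pairs of corners, transitivity excludes those with
exactly two related pairs. -/
theorem exists_rel_iff {r : Corner → Corner → Prop} (hr : Equivalence r) :
    ∃ p : Pattern, ∀ i j, r i j ↔ p.rel i j = true := by
  have h1 (i) : r i i := hr.refl i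
  have h2 {i j} : r i j → r j i := hr.symm
  have h3 {i j k} : r i j → r j k → r i k := hr.trans
  by_cases a : r .up .left <;> by_cases b : r .up .right <;> by_cases c : r .left .right
  · refine ⟨.joined, ?_⟩; rintro (_ | _ | _) (_ | _ | _) <;> simp [rel] <;> grind
  · exact absurd (h3 (h2 a) b) c
  · exact absurd (h3 a c) b
  · refine ⟨.single .right, ?_⟩; rintro (_ | _ | _) (_ | _ | _) <;> simp [rel] <;> grind
  · exact absurd (h3 b (h2 c)) a
  · refine ⟨.single .left, ?_⟩; rintro (_ | _ | _) (_ | _ | _) <;> simp [rel] <;> grind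
  · refine ⟨.single .up, ?_⟩; rintro (_ | _ | _) (_ | _ | _) <;> simp [rel] <;> grind
  · refine ⟨.discrete, ?_⟩; rintro (_ | _ | _) (_ | _ | _) <;> simp [rel] <;> grind

end Pattern

/-! ### Forests in which every component contains an outmost vertex. -/

namespace TriangleGraph

variable {G : TriangleGraph} {F : Finset G.Edge} {p : Pattern}

theorem card_le_card_add_card_connectedComponent [Finite G.verts] (F : Finset G.Edge) :
    Nat.card G.verts ≤ F.card + Nat.card (spanning F).ConnectedComponent := by
  have h := (spanning F).card_le_ncard_edgeSet_add_card_connectedComponent.1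
  have h1 : (spanning F).edgeSet.ncard ≤ F.card := by
    rw [spanning, SimpleGraph.edgeSet_fromEdgeSet, ← Set.ncard_coe_finset F]
    exact (Set.ncard_le_ncard Set.sdiff_subset (F.finite_toSet.image _)).trans
      (Set.ncard_image_le F.finite_toSet)
  omega

/-- In |V| ≤ edges of `spanning F` + components ≤ |`F`| + components, loops and parallel edges make
the second inequality strict and cycles the first. Equality throughout is thus equivalent to being a
forest. -/
theorem isSpanningForest_iff [Finite G.verts] {k : ℕ} :
    IsSpanningForest k F ↔ F.card + k = Nat.card G.verts ∧
      Nat.card (spanning F).ConnectedComponent = k := by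
  have hE : (spanning F).edgeSet = G.ends '' F \ Sym2.diagSet := by
    rw [spanning, SimpleGraph.edgeSet_fromEdgeSet]
  have hfin : (G.ends '' (F : Set G.Edge)).Finite := F.finite_toSet.image _
  have h1 : (G.ends '' (F : Set G.Edge)).ncard ≤ F.card := by
    rw [← Set.ncard_coe_finset F]
    exact Set.ncard_image_le F.finite_toSet
  have h2 : (spanning F).edgeSet.ncard ≤ (G.ends '' (F : Set G.Edge)).ncard := by
    rw [hE]
    exact Set.ncard_le_ncard Set.sdiff_subset hfin
  obtain ⟨h3, h4⟩ := (spanning F).card_le_ncard_edgeSet_add_card_connectedComponent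
  constructor
  · rintro ⟨hd, hi, ha, rfl⟩
    refine ⟨?_, rfl⟩
    rw [← ha.ncard_edgeSet_add_card_connectedComponent, hE, sdiff_eq_left.2,
      hi.ncard_image, Set.ncard_coe_finset]
    rw [Set.disjoint_left]
    rintro _ ⟨e, he, rfl⟩
    exact hd e he
  · rintro ⟨hk, rfl⟩
    refine ⟨fun e he hd => ?_, ?_, h4 (by omega), rfl⟩
    · have : (spanning F).edgeSet = G.ends '' F :=
        Set.eq_of_subset_of_ncard_le (hE ▸ Set.sdiff_subset) (by omega) hfin
      have h5 : G.ends e ∈ (spanning F).edgeSet := this ▸ ⟨e, he, rfl⟩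
      rw [hE] at h5
      exact h5.2 hd
    · refine Set.injOn_of_ncard_image_eq ?_ F.finite_toSet
      rw [Set.ncard_coe_finset]
      omega

/-- Every vertex is joined to an outmost vertex. -/
def Covered (F : Finset G.Edge) : Prop :=
  ∀ v, ∃ i, (spanning F).Reachable v (G.outmost i)

/-- The partition of the corners into the connected components is `p`. -/
def HasPattern (F : Finset G.Edge) (p : Pattern) : Prop :=
  ∀ i j, Joined F i j ↔ p.rel i j = true

theorem exists_hasPattern (F : Finset G.Edge) : ∃ p, HasPattern F p :=
  Pattern.exists_rel_iff ⟨fun _ => .rfl, fun h => h.symm, fun h h' => h.trans h'⟩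

theorem HasPattern.unique {q : Pattern} (hp : HasPattern F p) (hq : HasPattern F q) : p = q :=
  Pattern.rel_injective <| funext₂ fun i j => Bool.eq_iff_iff.2 ((hp i j).symm.trans (hq i j))

/-- The block representatives lie in `p.parts` distinct components, so they meet every component iff
there are no others. -/
theorem HasPattern.covered_iff [Finite G.verts] (hp : HasPattern F p) :
    Covered F ↔ Nat.card (spanning F).ConnectedComponent = p.parts := by
  set f : Corner → (spanning F).ConnectedComponent := fun i =>
    (spanning F).connectedComponentMk (G.outmost i) with hf
  have hfe (i j) : f i = f j ↔ p.rel i j = true := by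
    rw [← hp i j]
    exact SimpleGraph.ConnectedComponent.eq
  have hc : Covered F ↔ f '' (p.reps : Set Corner) = Set.univ := by
    rw [Set.eq_univ_iff_forall]
    constructor
    · intro h C
      induction C using SimpleGraph.ConnectedComponent.ind with | _ v
      obtain ⟨i, hi⟩ := h v
      obtain ⟨j, hj, hij⟩ := p.exists_mem_reps_rel i
      exact ⟨j, hj, ((hfe i j).2 hij).symm.trans (SimpleGraph.ConnectedComponent.sound hi.symm)⟩
    · intro h v
      obtain ⟨j, -, hj⟩ := h ((spanning F).connectedComponentMk v)
      exact ⟨j, (SimpleGraph.ConnectedComponent.exact hj).symm⟩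
  have hn : (f '' (p.reps : Set Corner)).ncard = p.parts := by
    rw [Set.InjOn.ncard_image, Set.ncard_coe_finset, p.card_reps]
    exact fun i hi j hj hij => p.eq_of_rel_of_mem_reps i hi j hj ((hfe i j).1 hij)
  rw [hc, ← hn, ← Set.ncard_univ]
  exact ⟨fun h => by rw [h], fun h => Set.eq_of_subset_of_ncard_le (Set.subset_univ _) h.le⟩

/-- `F` is the edge set of a spanning forest each of whose components contains an outmost vertex,
and `p` is the partition of the corners into components. -/
structure IsPatternForest (F : Finset G.Edge) (p : Pattern) : Prop where
  covered : Covered F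
  hasPattern : HasPattern F p
  card : F.card + p.parts = Nat.card G.verts

theorem HasPattern.isSpanningForest_iff [Finite G.verts] (hp : HasPattern F p) :
    IsSpanningForest p.parts F ↔ IsPatternForest F p := by
  rw [TriangleGraph.isSpanningForest_iff, ← hp.covered_iff]
  exact ⟨fun h => ⟨h.2, hp, h.1⟩, fun h => ⟨h.card, h.covered⟩⟩

theorem isPatternForest_iff [Finite G.verts] :
    IsPatternForest F p ↔ IsSpanningForest p.parts F ∧ HasPattern F p :=
  ⟨fun h => ⟨h.hasPattern.isSpanningForest_iff.2 h, h.hasPattern⟩,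
    fun h => h.2.isSpanningForest_iff.1 h.1⟩

variable (G)
variable {R : Type*} [CommSemiring R] (w : Label → R)

/-- Weighted generating function of the spanning forests with pattern `p`. -/
noncomputable def patternGF (p : Pattern) : R :=
  G.genFun w fun F => IsPatternForest F p

theorem genFun_congr {P Q : Finset G.Edge → Prop} (h : ∀ F, P F ↔ Q F) :
    G.genFun w P = G.genFun w Q := by
  rw [funext fun F => propext (h F)]

theorem treeGF_eq [Finite G.verts] : G.treeGF w = G.patternGF w .joined := by
  refine G.genFun_congr w fun F => ?_
  rw [isPatternForest_iff]
  refine ⟨fun h => ⟨h, fun i j => ⟨fun _ => rfl, fun _ => ?_⟩⟩, fun h => h.1⟩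
  have := (Nat.card_eq_one_iff_unique.1 h.2.2.2).1
  exact SimpleGraph.ConnectedComponent.exact (Subsingleton.elim _ _)

theorem twoForestGF_eq [Finite G.verts] (k : Corner) :
    G.twoForestGF w k = G.patternGF w (.single k) := by
  refine G.genFun_congr w fun F => ?_
  rw [isPatternForest_iff]
  refine and_congr Iff.rfl ?_
  have hs {i j} (h : Joined F i j) : Joined F j i := SimpleGraph.Reachable.symm h
  have hr {i} : Joined F i i := SimpleGraph.Reachable.refl _
  unfold HasPattern
  simp only [Pattern.rel, Bool.or_eq_true, decide_eq_true_eq, Bool.and_eq_true]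
  constructor
  · intro h i j
    by_cases hi : i = k <;> by_cases hj : j = k
    · simp [hi, hj, hr]
    · have := fun h' => (h j j hj hj).2 (hs h')
      grind
    · have := (h i i hi hi).2
      grind
    · have := (h i j hi hj).1
      grind
  · intro h i j hi hj
    exact ⟨(h i j).2 (Or.inr ⟨hi, hj⟩), fun h' => by have := (h i k).1 h'; grind⟩

theorem threeForestGF_eq [Finite G.verts] : G.threeForestGF w = G.patternGF w .discrete := by
  refine G.genFun_congr w fun F => ?_
  rw [isPatternForest_iff]
  refine and_congr Iff.rfl ?_
  have hr {i} : Joined F i i := SimpleGraph.Reachable.refl _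
  simp only [HasPattern, Pattern.rel, decide_eq_true_eq]
  constructor
  · intro h i j
    by_cases hij : i = j
    · simp [hij, hr]
    · simp [hij, h i j hij]
  · intro h i j hij
    rw [h]
    exact hij

end TriangleGraph

/-! ### How the patterns of three copies combine. -/

namespace Corner

theorem reflect_reflect (k i : Corner) : k.reflect (k.reflect i) = i := by
  revert k i; decide

theorem reflect_ne {k i : Corner} (h : i ≠ k) : k.reflect i ≠ k ∧ k.reflect i ≠ i := by
  revert k i; decide

theorem eq_reflect {i j k : Corner} (hij : i ≠ j) (hik : i ≠ k) (hjk : j ≠ k) :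
    i = j.reflect k := by
  revert i j k; decide

theorem univ_eq : (Finset.univ : Finset Corner) = {.up, .left, .right} := rfl

end Corner

/-- The corner `i` of the copy placed at `k`, as one of the six corners of the copies: `(i, true)`
is the outmost vertex `i`, and `(i, false)` is the midpoint of the side opposite to `i`. -/
def copyNode (k i : Corner) : Corner × Bool := (i, decide (i = k))

namespace Pattern

/-- The midpoints opposite to `i` and `j` are connected, when the corners of the copy at each `k`
are connected according to `q k`. -/
def midJoined (q : Corner → Pattern) (i j : Corner) : Bool :=
  decide (i = j) || (q (i.reflect j)).rel i j ||
    ((q j).rel i (i.reflect j) && (q i).rel (i.reflect j) j)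

/-- The outmost vertex `k` and the midpoint opposite to `i` are connected. -/
def outMidJoined (q : Corner → Pattern) (k i : Corner) : Bool :=
  decide (∃ j, j ≠ k ∧ (q k).rel j k = true ∧ midJoined q i j = true)

/-- A corner of one of the copies is connected to the outmost vertex `l`. -/
def joinedTo (q : Corner → Pattern) (l : Corner) : Corner × Bool → Bool
  | (i, false) => outMidJoined q l i
  | (k, true) => decide (k = l ∨ ∃ i, i ≠ k ∧ (q k).rel k i = true ∧ outMidJoined q l i = true)

/-- If the copy at `k` carries a forest of pattern `q k` for each `k`, then the union is a
forest of pattern `p`. -/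
def Glues (q : Corner → Pattern) (p : Pattern) : Prop :=
  (∀ i j, joinedTo q j (i, true) = p.rel i j) ∧ (∀ i, ∃ l, joinedTo q l (i, false) = true) ∧
    (q .up).parts + (q .left).parts + (q .right).parts = p.parts + 3

instance (q : Corner → Pattern) (p : Pattern) : Decidable (Glues q p) := by
  unfold Glues; infer_instance

/-- The family of the three given patterns. -/
def triple (u l r : Pattern) : Corner → Pattern
  | .up => u
  | .left => l
  | .right => r

theorem triple_eta (q : Corner → Pattern) : triple (q .up) (q .left) (q .right) = q := by
  funext k; cases k <;> rfl

theorem joinedTo_self (q : Corner → Pattern) (l : Corner) : joinedTo q l (l, true) = true := by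
  simp [joinedTo]

/-- `joinedTo` inspects only paths of bounded length. This closure under the relation of each copy
shows that longer paths give nothing new. -/
theorem joinedTo_copyNode {q : Corner → Pattern} {k l i j : Corner} (h : (q k).rel i j = true)
    (hi : joinedTo q l (copyNode k i) = true) : joinedTo q l (copyNode k j) = true := by
  have key : ∀ u v w : Pattern, ∀ k l i j : Corner, (triple u v w k).rel i j = true →
      joinedTo (triple u v w) l (copyNode k i) = true →
      joinedTo (triple u v w) l (copyNode k j) = true := by
    decide +kernel
  have := key (q .up) (q .left) (q .right) k l i j
  rw [triple_eta] at this
  exact this h hi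

/-- Replace each copy by a forest on its corners with 3 minus `parts` edges. The resulting graph has
six nodes and `p.parts` components, so 6 ≤ 9 - Σ `parts` + `p.parts`. The proof itself is a finite
check. -/
theorem sum_parts_le {q : Corner → Pattern} {p : Pattern}
    (hp : ∀ i j, joinedTo q j (i, true) = p.rel i j)
    (hc : ∀ i, ∃ l, joinedTo q l (i, false) = true) :
    (q .up).parts + (q .left).parts + (q .right).parts ≤ p.parts + 3 := by
  have key : ∀ u v w p : Pattern, (∀ i j, joinedTo (triple u v w) j (i, true) = p.rel i j) →
      (∀ i, ∃ l, joinedTo (triple u v w) l (i, false) = true) →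
      u.parts + v.parts + w.parts ≤ p.parts + 3 := by
    decide +kernel
  have := key (q .up) (q .left) (q .right) p
  rw [triple_eta] at this
  exact this hp hc

/-- For `i ≠ j`, `i.reflect j` is the third corner. Its copy contains both midpoints; the detour
passes through the midpoint opposite to it, inside the copies at `j` and `i`. `S` will be
reachability in the glued graph. -/
theorem sound_of_midJoined {q : Corner → Pattern} {S : Corner × Bool → Corner × Bool → Prop}
    (hS : Equivalence S)
    (h : ∀ k i j, (q k).rel i j = true → S (copyNode k i) (copyNode k j)) {i j : Corner}
    (hij : midJoined q i j = true) : S (i, false) (j, false) := by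
  by_cases e : i = j
  · subst e
    exact hS.refl _
  have hin {k i j : Corner} (hi : i ≠ k) (hj : j ≠ k) (hr : (q k).rel i j = true) :
      S (i, false) (j, false) := by
    simpa [copyNode, hi, hj] using h k i j hr
  obtain ⟨h1, h2⟩ := Corner.reflect_ne (Ne.symm e)
  simp only [midJoined, e, decide_false, Bool.false_or, Bool.or_eq_true, Bool.and_eq_true] at hij
  rcases hij with hij | ⟨hij, hij'⟩
  · exact hin h1.symm h2.symm hij
  · exact hS.trans (hin e h2 hij) (hin h1 (Ne.symm e) hij')

theorem sound_of_outMidJoined {q : Corner → Pattern} {S : Corner × Bool → Corner × Bool → Prop}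
    (hS : Equivalence S)
    (h : ∀ k i j, (q k).rel i j = true → S (copyNode k i) (copyNode k j)) {k i : Corner}
    (hk : outMidJoined q k i = true) : S (i, false) (k, true) := by
  obtain ⟨j, hj, hr, hm⟩ := of_decide_eq_true hk
  refine hS.trans (sound_of_midJoined hS h hm) ?_
  simpa [copyNode, hj] using h k j k hr

theorem sound_of_joinedTo {q : Corner → Pattern} {S : Corner × Bool → Corner × Bool → Prop}
    (hS : Equivalence S)
    (h : ∀ k i j, (q k).rel i j = true → S (copyNode k i) (copyNode k j)) {l : Corner}
    {n : Corner × Bool} (hn : joinedTo q l n = true) : S n (l, true) := by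
  obtain ⟨k, _ | _⟩ := n
  · exact sound_of_outMidJoined hS h hn
  · rcases of_decide_eq_true hn with rfl | ⟨i, hi, hr, ho⟩
    · exact hS.refl _
    · refine hS.trans ?_ (sound_of_outMidJoined hS h ho)
      simpa [copyNode, hi] using h k k i hr

end Pattern

/-! ### Coordinates of the copies and their intersections. -/

theorem placeCopy_injective (N : ℕ) (k : Corner) : Function.Injective (placeCopy N k) := by
  intro x y h
  funext i
  have := congrFun h (k.reflect i)
  simpa [placeCopy, Corner.reflect_reflect] using this

/-- The right side does not depend on `k`: the two copies away from `i` share this midpoint. -/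
theorem placeCopy_cornerPoint {N : ℕ} {k i : Corner} (h : i ≠ k) (j : Corner) :
    placeCopy N k (cornerPoint N i) j = if j = i then 0 else N := by
  have h2 : k.reflect j = i ↔ j ≠ i ∧ j ≠ k := by revert i j k; decide
  have h3 : j = k → j ≠ i := fun e => e ▸ h.symm
  simp only [placeCopy, cornerPoint, Pi.single_apply]
  grind

namespace TriangleGraph

/-- The vertices of `G` are lattice points of the triangle of side length `G.side > 0`, and the
outmost vertices are its corners. -/
structure IsInscribed (G : TriangleGraph) : Prop where
  side_pos : 0 < G.side
  finite : Finite G.verts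
  sum_eq : ∀ x ∈ G.verts, x .up + x .left + x .right = G.side
  outmost_eq : ∀ k, (G.outmost k : Point) = cornerPoint G.side k

variable {G : TriangleGraph}

theorem IsInscribed.finite_gluedVerts (hG : G.IsInscribed) : G.gluedVerts.Finite := by
  have : G.verts.Finite := hG.finite
  exact Set.finite_iUnion fun k => this.image _

theorem isInscribed_triangle : triangle.IsInscribed where
  side_pos := Nat.one_pos
  finite := Set.finite_range _
  sum_eq := by
    rintro _ ⟨k, rfl⟩
    cases k <;> simp [cornerPoint, triangle]
  outmost_eq _ := rfl

theorem IsInscribed.glue (hG : G.IsInscribed) : G.glue.IsInscribed where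
  side_pos := Nat.mul_pos two_pos hG.side_pos
  finite := hG.finite_gluedVerts
  sum_eq := by
    intro x hx
    obtain ⟨k, y, hy, rfl⟩ := Set.mem_iUnion.1 hx
    have := hG.sum_eq y hy
    cases k <;> simp [placeCopy, cornerPoint, Corner.reflect, TriangleGraph.glue] <;> omega
  outmost_eq := by
    intro k
    change placeCopy G.side k (G.outmost k) = cornerPoint (2 * G.side) k
    rw [hG.outmost_eq]
    funext i
    have h2 : k.reflect i = k ↔ i = k := by revert i k; decide
    simp only [placeCopy, cornerPoint, Pi.single_apply, h2]
    split <;> omega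

/-- The inclusion of the vertices of the copy placed at `k` into the glued graph. -/
def toGlue (G : TriangleGraph) (k : Corner) (x : G.verts) : G.glue.verts := G.copyVert k x

/-- The edges of the glued graph. -/
def glueEdge (G : TriangleGraph) : Corner × G.Edge ≃ G.glue.Edge := Equiv.refl _

theorem glue_ends (e : Corner × G.Edge) :
    G.glue.ends (G.glueEdge e) = (G.ends e.2).map (G.toGlue e.1) := rfl

theorem copyVert_injective (k : Corner) : Function.Injective (G.toGlue k) := fun _ _ h =>
  Subtype.ext (placeCopy_injective _ _ (congrArg Subtype.val h))

/-- A point of the copy at `k` has `k`-th coordinate at least `G.side`. A common point has two such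
coordinates and coordinate sum `2 * G.side`, so it is the midpoint between the corners `k` and `l`.
-/
theorem IsInscribed.eq_outmost (hG : G.IsInscribed) {k l : Corner} (hkl : k ≠ l) {x y : G.verts}
    (h : G.toGlue k x = G.toGlue l y) : x = G.outmost (k.reflect l) := by
  have h : placeCopy G.side k x = placeCopy G.side l y := congrArg Subtype.val h
  have h1 := congrFun h .up
  have h2 := congrFun h .left
  have h3 := congrFun h .right
  have hx := hG.sum_eq x x.2
  have hy := hG.sum_eq y y.2
  apply Subtype.ext
  rw [hG.outmost_eq]
  funext i
  cases k <;> cases l <;> first | exact absurd rfl hkl | skip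
  all_goals
    simp [placeCopy, cornerPoint, Corner.reflect] at h1 h2 h3
    cases i <;> simp [cornerPoint, Corner.reflect] <;> omega

theorem IsInscribed.toGlue_outmost (hG : G.IsInscribed) {k l i : Corner} (hk : i ≠ k)
    (hl : i ≠ l) : G.toGlue k (G.outmost i) = G.toGlue l (G.outmost i) := by
  apply Subtype.ext
  change placeCopy G.side k (G.outmost i) = placeCopy G.side l (G.outmost i)
  rw [hG.outmost_eq]
  funext j
  rw [placeCopy_cornerPoint hk, placeCopy_cornerPoint hl]

theorem IsInscribed.image_inter_image (hG : G.IsInscribed) {k l i : Corner} (hkl : k ≠ l)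
    (hk : i ≠ k) (hl : i ≠ l) :
    Set.range (G.toGlue k) ∩ Set.range (G.toGlue l) = {G.toGlue k (G.outmost i)} := by
  ext v
  simp only [Set.mem_inter_iff, Set.mem_range, Set.mem_singleton_iff]
  constructor
  · rintro ⟨⟨x, rfl⟩, y, hy⟩
    rw [hG.eq_outmost hkl hy.symm, ← Corner.eq_reflect hk hl hkl]
  · rintro rfl
    exact ⟨⟨_, rfl⟩, _, (hG.toGlue_outmost hk hl).symm⟩

theorem IsInscribed.outmost_ne (hG : G.IsInscribed) {i j : Corner} (h : i ≠ j) :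
    G.outmost i ≠ G.outmost j := by
  intro e
  have e := congrFun (congrArg Subtype.val e) i
  have := hG.side_pos
  simp [hG.outmost_eq, cornerPoint, h] at e
  omega

theorem exists_copyVert_eq (v : G.glue.verts) : ∃ k x, G.toGlue k x = v := by
  obtain ⟨v, hv⟩ := v
  obtain ⟨k, y, hy, rfl⟩ := Set.mem_iUnion.1 hv
  exact ⟨k, ⟨y, hy⟩, rfl⟩

/-- Inclusion–exclusion: the first two copies share one vertex, and their union meets the third in
two. -/
theorem IsInscribed.card_glue_verts (hG : G.IsInscribed) :
    Nat.card G.glue.verts + 3 = 3 * Nat.card G.verts := by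
  have := hG.finite
  have : Finite G.glue.verts := hG.glue.finite
  have hr (k) : (Set.range (G.toGlue k)).ncard = Nat.card G.verts := by
    rw [← Set.image_univ, Set.ncard_image_of_injective _ (copyVert_injective k), Set.ncard_univ]
  have hu : Set.range (G.toGlue .up) ∪ Set.range (G.toGlue .left) ∪
      Set.range (G.toGlue .right) = Set.univ := by
    refine Set.eq_univ_of_forall fun v => ?_
    obtain ⟨k, x, rfl⟩ := exists_copyVert_eq v
    cases k <;> simp
  have h1 := Set.ncard_union_add_ncard_inter (Set.range (G.toGlue .up))
    (Set.range (G.toGlue .left))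
  have h2 := Set.ncard_union_add_ncard_inter
    (Set.range (G.toGlue .up) ∪ Set.range (G.toGlue .left)) (Set.range (G.toGlue .right))
  rw [hG.image_inter_image (i := .right) (by decide) (by decide) (by decide),
    Set.ncard_singleton] at h1
  rw [hu, Set.union_inter_distrib_right,
    hG.image_inter_image (i := .left) (by decide) (by decide) (by decide),
    hG.image_inter_image (i := .up) (by decide) (by decide) (by decide),
    hG.toGlue_outmost (k := .up) (l := .right) (by decide) (by decide),
    hG.toGlue_outmost (k := .left) (l := .right) (by decide) (by decide),
    Set.singleton_union, Set.ncard_pair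
      ((copyVert_injective _).ne (hG.outmost_ne (by decide))), Set.ncard_univ] at h2
  rw [hr, hr] at h1
  rw [hr] at h2
  omega

/-! ### Edge sets and connectivity of the glued graph. -/

/-- The union of edge sets of the three copies. -/
noncomputable def assemble (H : Corner → Finset G.Edge) : Finset G.glue.Edge :=
  (Finset.univ.sigma H).map ((Equiv.sigmaEquivProd Corner G.Edge).trans G.glueEdge).toEmbedding

theorem mem_assemble {H : Corner → Finset G.Edge} {e : Corner × G.Edge} :
    G.glueEdge e ∈ assemble H ↔ e.2 ∈ H e.1 := by
  obtain ⟨k, e⟩ := e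
  simp [assemble]

theorem card_assemble (H : Corner → Finset G.Edge) :
    (assemble H).card = (H .up).card + (H .left).card + (H .right).card := by
  rw [assemble, Finset.card_map, Finset.card_sigma, Corner.univ_eq]
  simp [add_assoc]

theorem assemble_bijective : Function.Bijective (assemble (G := G)) := by
  classical
  constructor
  · intro H K h
    funext k
    ext e
    rw [← mem_assemble (e := (k, e)), h, mem_assemble]
  · intro F
    refine ⟨fun k => Finset.univ.filter fun e => G.glueEdge (k, e) ∈ F, ?_⟩
    ext e
    obtain ⟨e, rfl⟩ := G.glueEdge.surjective e
    simp [mem_assemble]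

theorem weight_assemble {R : Type*} [CommSemiring R] (w : Label → R)
    (H : Corner → Finset G.Edge) : weight w (assemble H) = ∏ k, weight w (H k) := by
  rw [weight, assemble, Finset.prod_map, Finset.prod_sigma]
  rfl

variable {H : Corner → Finset G.Edge}

theorem reachable_copyVert {k : Corner} {x y : G.verts} (h : (spanning (H k)).Reachable x y) :
    (spanning (assemble H)).Reachable (G.toGlue k x) (G.toGlue k y) := by
  rw [SimpleGraph.reachable_iff_reflTransGen] at h
  induction h with
  | refl => exact .rfl
  | tail _ h ih =>
    refine ih.trans (SimpleGraph.Adj.reachable ?_)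
    rw [spanning, SimpleGraph.fromEdgeSet_adj] at h ⊢
    obtain ⟨⟨e, he, hxy⟩, hne⟩ := h
    refine ⟨⟨G.glueEdge (k, e), mem_assemble.2 he, ?_⟩, (copyVert_injective k).ne hne⟩
    rw [glue_ends, hxy]
    rfl

theorem exists_adj_of_adj_assemble {v v' : G.glue.verts}
    (h : (spanning (assemble H)).Adj v v') : ∃ k x x', G.toGlue k x = v ∧
      G.toGlue k x' = v' ∧ (spanning (H k)).Adj x x' := by
  rw [spanning, SimpleGraph.fromEdgeSet_adj] at h
  obtain ⟨⟨e, he, hvv⟩, hne⟩ := h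
  obtain ⟨⟨k, e⟩, rfl⟩ := G.glueEdge.surjective e
  have he := mem_assemble.1 he
  rw [glue_ends] at hvv
  induction hxy : G.ends e with | _ x y
  simp only [hxy, Sym2.map_mk, Sym2.eq_iff] at hvv
  have hadj : x ≠ y → (spanning (H k)).Adj x y := fun hn => by
    rw [spanning, SimpleGraph.fromEdgeSet_adj]
    exact ⟨⟨e, he, hxy⟩, hn⟩
  rcases hvv with ⟨rfl, rfl⟩ | ⟨rfl, rfl⟩
  · exact ⟨k, x, y, rfl, rfl, hadj fun h => hne (h ▸ rfl)⟩
  · exact ⟨k, y, x, rfl, rfl, (hadj fun h => hne (h ▸ rfl)).symm⟩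

/-- The vertex of the glued graph at a corner of one of the copies. -/
def nodeVert (G : TriangleGraph) : Corner × Bool → G.glue.verts
  | (k, true) => G.toGlue k (G.outmost k)
  | (.up, false) => G.toGlue .left (G.outmost .up)
  | (.left, false) => G.toGlue .right (G.outmost .left)
  | (.right, false) => G.toGlue .up (G.outmost .right)

theorem IsInscribed.nodeVert_copyNode (hG : G.IsInscribed) (k i : Corner) :
    G.nodeVert (copyNode k i) = G.toGlue k (G.outmost i) := by
  by_cases h : i = k
  · subst h
    simp [copyNode, nodeVert]
  · cases i <;> simp only [copyNode, h, decide_false, nodeVert] <;>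
      exact hG.toGlue_outmost (by decide) h

theorem IsInscribed.reachable_of_joinedTo (hG : G.IsInscribed) {q : Corner → Pattern}
    (hq : ∀ k, HasPattern (H k) (q k)) {l : Corner} {n : Corner × Bool}
    (h : Pattern.joinedTo q l n = true) :
    (spanning (assemble H)).Reachable (G.nodeVert n) (G.glue.outmost l) := by
  refine Pattern.sound_of_joinedTo (S := fun m n =>
    (spanning (assemble H)).Reachable (G.nodeVert m) (G.nodeVert n))
    ⟨fun _ => .rfl, fun h => h.symm, fun h h' => h.trans h'⟩ (fun k i j hij => ?_) h
  rw [hG.nodeVert_copyNode, hG.nodeVert_copyNode]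
  exact reachable_copyVert ((hq k i j).2 hij)

/-- Induction along a walk from the outmost vertex `l`. Each edge lies inside one copy, and a change
of copy occurs only at a shared midpoint. Quantifying over every copy that contains `v` lets the
walk continue in any of them. -/
theorem IsInscribed.exists_reachable_outmost (hG : G.IsInscribed) {q : Corner → Pattern}
    (hq : ∀ k, HasPattern (H k) (q k)) {l : Corner} {v : G.glue.verts}
    (h : (spanning (assemble H)).Reachable (G.glue.outmost l) v) (k : Corner) (x : G.verts)
    (hx : G.toGlue k x = v) : ∃ i, (spanning (H k)).Reachable x (G.outmost i) ∧
      Pattern.joinedTo q l (copyNode k i) = true := by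
  have key {k x} (h : ∃ i, (spanning (H k)).Reachable x (G.outmost i) ∧
      Pattern.joinedTo q l (copyNode k i) = true) {m y} (hy : G.toGlue m y = G.toGlue k x) :
      ∃ i, (spanning (H m)).Reachable y (G.outmost i) ∧
        Pattern.joinedTo q l (copyNode m i) = true := by
    by_cases hmk : m = k
    · subst hmk
      rwa [copyVert_injective _ hy]
    · obtain ⟨i, hi, hj⟩ := h
      have h1 := (Corner.reflect_ne (Ne.symm hmk))
      rw [hG.eq_outmost hmk hy]
      rw [hG.eq_outmost (Ne.symm hmk) hy.symm] at hi
      -- Both are the third corner, so the shared midpoint is the same corner of either copy.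
      have e : m.reflect k = k.reflect m := by
        clear * -
        revert m k; decide
      refine ⟨_, .rfl, ?_⟩
      have := Pattern.joinedTo_copyNode ((hq k _ _).1 hi.symm) hj
      rw [← e] at this
      simpa [copyNode, h1.1, h1.2] using this
  rw [SimpleGraph.reachable_iff_reflTransGen] at h
  induction h generalizing k x with
  | refl =>
    refine key (k := l) (x := G.outmost l) ⟨l, .rfl, ?_⟩ hx
    simpa [copyNode] using Pattern.joinedTo_self q l
  | tail _ h ih =>
    obtain ⟨m, y, y', hy, hy', hadj⟩ := exists_adj_of_adj_assemble h
    obtain ⟨i, hi, hj⟩ := ih m y hy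
    exact key ⟨i, hadj.symm.reachable.trans hi, hj⟩ (hx.trans hy'.symm)

theorem IsInscribed.joinedTo_iff (hG : G.IsInscribed) {q : Corner → Pattern}
    (hq : ∀ k, HasPattern (H k) (q k)) {l k i : Corner} :
    Pattern.joinedTo q l (copyNode k i) = true ↔
      (spanning (assemble H)).Reachable (G.toGlue k (G.outmost i)) (G.glue.outmost l) := by
  rw [← hG.nodeVert_copyNode]
  refine ⟨hG.reachable_of_joinedTo hq, fun h => ?_⟩
  obtain ⟨j, hj, hl⟩ := hG.exists_reachable_outmost hq h.symm k (G.outmost i)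
    (hG.nodeVert_copyNode k i).symm
  exact Pattern.joinedTo_copyNode ((hq k _ _).1 hj.symm) hl

theorem IsInscribed.joined_assemble (hG : G.IsInscribed) {q : Corner → Pattern}
    (hq : ∀ k, HasPattern (H k) (q k)) {i j : Corner} :
    Joined (assemble H) i j ↔ Pattern.joinedTo q j (i, true) = true := by
  have := hG.joinedTo_iff hq (l := j) (k := i) (i := i)
  simp only [copyNode, decide_true] at this
  exact this.symm

theorem IsInscribed.covered_assemble (hG : G.IsInscribed) {q : Corner → Pattern}
    (hq : ∀ k, HasPattern (H k) (q k)) : Covered (assemble H) ↔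
      (∀ k, Covered (H k)) ∧ ∀ i, ∃ l, Pattern.joinedTo q l (i, false) = true := by
  constructor
  · intro h
    constructor
    · intro k x
      obtain ⟨l, hl⟩ := h (G.toGlue k x)
      obtain ⟨i, hi, -⟩ := hG.exists_reachable_outmost hq hl.symm k x rfl
      exact ⟨i, hi⟩
    · intro i
      obtain ⟨k, hk⟩ : ∃ k, i ≠ k := by revert i; decide
      obtain ⟨l, hl⟩ := h (G.toGlue k (G.outmost i))
      have := (hG.joinedTo_iff hq).2 hl
      exact ⟨l, by simpa [copyNode, hk] using this⟩
  · rintro ⟨h, h'⟩ v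
    obtain ⟨k, x, rfl⟩ := exists_copyVert_eq v
    obtain ⟨i, hi⟩ := h k x
    suffices ∃ l, Pattern.joinedTo q l (copyNode k i) = true by
      obtain ⟨l, hl⟩ := this
      exact ⟨l, (reachable_copyVert hi).trans ((hG.joinedTo_iff hq).1 hl)⟩
    by_cases hik : i = k
    · exact ⟨i, by simpa [copyNode, hik] using Pattern.joinedTo_self q k⟩
    · simpa [copyNode, hik] using h' i

/-! ### Decomposition of forests and of their generating functions. -/

theorem IsInscribed.isPatternForest_assemble (hG : G.IsInscribed) {p : Pattern} :
    IsPatternForest (assemble H) p ↔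
      ∃ q, Pattern.Glues q p ∧ ∀ k, IsPatternForest (H k) (q k) := by
  have := hG.finite
  have hV := hG.card_glue_verts
  have hH := card_assemble H
  constructor
  · intro h
    choose q hq using fun k => exists_hasPattern (H k)
    have hp : ∀ i j, Pattern.joinedTo q j (i, true) = p.rel i j := fun i j =>
      Bool.eq_iff_iff.2 ((hG.joined_assemble hq).symm.trans (h.hasPattern i j))
    obtain ⟨hc, hm⟩ := (hG.covered_assemble hq).1 h.covered
    have hle := Pattern.sum_parts_le hp hm
    have hF := h.card
    -- Summed over `k`, these bounds and `hle` give 3|V| ≤ Σ|`H k`| + `p.parts` + 3, which by `hF`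
    -- and `hV` is an equality; hence each bound is one.
    have hk (k) : Nat.card G.verts ≤ (H k).card + (q k).parts :=
      ((hq k).covered_iff.1 (hc k)) ▸ card_le_card_add_card_connectedComponent (H k)
    have h1 := hk .up
    have h2 := hk .left
    have h3 := hk .right
    refine ⟨q, ⟨hp, hm, by omega⟩, fun k => ⟨hc k, hq k, ?_⟩⟩
    cases k <;> omega
  · rintro ⟨q, ⟨hp, hm, hs⟩, hq⟩
    have hq' k := (hq k).hasPattern
    refine ⟨(hG.covered_assemble hq').2 ⟨fun k => (hq k).covered, hm⟩, fun i j => ?_, ?_⟩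
    · rw [hG.joined_assemble hq', hp]
    · have h1 := (hq .up).card
      have h2 := (hq .left).card
      have h3 := (hq .right).card
      omega

theorem IsInscribed.patternGF_glue (hG : G.IsInscribed) {R : Type*} [CommSemiring R]
    (w : Label → R) (p : Pattern) : G.glue.patternGF w p =
      ∑ q : Corner → Pattern with Pattern.Glues q p, ∏ k, G.patternGF w (q k) := by
  classical
  simp only [patternGF, genFun, Finset.sum_filter]
  simp only [Finset.prod_univ_sum, Fintype.piFinset_univ, Finset.prod_ite_zero]
  rw [← assemble_bijective.sum_comp]
  simp only [weight_assemble, hG.isPatternForest_assemble]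
  -- The existential over `q` becomes a sum over `q` because `H` determines its patterns: at most
  -- one term is nonzero.
  trans ∑ q : Corner → Pattern, ∑ H : Corner → Finset G.Edge,
    if Pattern.Glues q p ∧ ∀ k, IsPatternForest (H k) (q k) then ∏ k, weight w (H k) else 0
  · rw [Finset.sum_comm]
    refine Finset.sum_congr rfl fun H _ => ?_
    by_cases h : ∃ q, Pattern.Glues q p ∧ ∀ k, IsPatternForest (H k) (q k)
    · rw [if_pos h]
      obtain ⟨q, h⟩ := h
      rw [Finset.sum_eq_single q, if_pos h]
      · intro q' _ hne
        rw [if_neg]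
        exact fun h' => hne (funext fun k => (h'.2 k).hasPattern.unique (h.2 k).hasPattern)
      · simp
    · rw [if_neg h]
      exact (Finset.sum_eq_zero fun q _ => if_neg fun h' => h ⟨q, h'⟩).symm
  · refine Finset.sum_congr rfl fun q _ => ?_
    by_cases h : Pattern.Glues q p <;> simp [h]

end TriangleGraph

/-! ### Enumeration of the admissible triples. -/

namespace Pattern

variable {A : Type*} [CommSemiring A]

theorem sum_glues_eq_sum_list (p : Pattern) (l : List (Pattern × Pattern × Pattern))
    (hl : l.Nodup ∧ ∀ u v w, Glues (triple u v w) p ↔ (u, v, w) ∈ l) (g : Pattern → A) :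
    ∑ q : Corner → Pattern with Glues q p, ∏ k, g (q k) =
      (l.map fun t => g t.1 * (g t.2.1 * g t.2.2)).sum := by
  rw [← List.sum_toFinset _ hl.1]
  refine Finset.sum_bij' (fun q _ => (q .up, q .left, q .right))
    (fun t _ => triple t.1 t.2.1 t.2.2) ?_ ?_ ?_ ?_ ?_
  · intro q hq
    rw [List.mem_toFinset, ← hl.2, triple_eta]
    exact (Finset.mem_filter.1 hq).2
  · rintro ⟨u, v, w⟩ ht
    exact Finset.mem_filter.2 ⟨Finset.mem_univ _, (hl.2 u v w).2 (List.mem_toFinset.1 ht)⟩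
  · exact fun q _ => triple_eta q
  · exact fun t _ => rfl
  · intro q _
    rw [Corner.univ_eq, Finset.prod_insert (by decide), Finset.prod_insert (by decide),
      Finset.prod_singleton]

/-- Three trees would close a cycle through the midpoints. So exactly one copy carries a 2-forest,
and it must not isolate its own outer corner: six choices. -/
theorem sum_glues_joined (g : Pattern → A) :
    ∑ q : Corner → Pattern with Glues q .joined, ∏ k, g (q k) =
      2 * g .joined ^ 2 * (g (.single .up) + g (.single .right) + g (.single .left)) := by
  rw [sum_glues_eq_sum_list _ [
        (.joined, .joined, .single .up), (.joined, .joined, .single .left),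
        (.joined, .single .up, .joined), (.joined, .single .right, .joined),
        (.single .left, .joined, .joined), (.single .right, .joined, .joined)]
      (by decide +kernel)]
  simp only [List.map_cons, List.map_nil, List.sum_cons, List.sum_nil]
  ring

/-- The block counts add up to 5, hence are 1, 2, 2 or 1, 1, 3 in some order. -/
theorem sum_glues_single_up (g : Pattern → A) :
    ∑ q : Corner → Pattern with Glues q (.single .up), ∏ k, g (q k) =
      g .joined * (3 * g (.single .left) * g (.single .right) +
        g (.single .up) * g (.single .right) + g (.single .up) * g (.single .left) +
        2 * g (.single .up) ^ 2) +
      g .joined ^ 2 * g .discrete := by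
  rw [sum_glues_eq_sum_list _ [
        (.joined, .single .right, .single .left), (.single .up, .joined, .single .up),
        (.single .up, .joined, .single .left), (.single .up, .single .up, .joined),
        (.single .up, .single .right, .joined), (.single .left, .single .right, .joined),
        (.single .right, .joined, .single .left), (.discrete, .joined, .joined)]
      (by decide +kernel)]
  simp only [List.map_cons, List.map_nil, List.sum_cons, List.sum_nil]
  ring

theorem sum_glues_single_left (g : Pattern → A) :
    ∑ q : Corner → Pattern with Glues q (.single .left), ∏ k, g (q k) =
      g .joined * (3 * g (.single .up) * g (.single .right) +
        g (.single .left) * g (.single .right) + g (.single .left) * g (.single .up) +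
        2 * g (.single .left) ^ 2) +
      g .joined ^ 2 * g .discrete := by
  rw [sum_glues_eq_sum_list _ [
        (.joined, .single .left, .single .up), (.joined, .single .left, .single .left),
        (.joined, .single .right, .single .up), (.joined, .discrete, .joined),
        (.single .left, .single .left, .joined), (.single .right, .joined, .single .up),
        (.single .right, .single .up, .joined), (.single .right, .single .left, .joined)]
      (by decide +kernel)]
  simp only [List.map_cons, List.map_nil, List.sum_cons, List.sum_nil]
  ring

theorem sum_glues_single_right (g : Pattern → A) :
    ∑ q : Corner → Pattern with Glues q (.single .right), ∏ k, g (q k) =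
      g .joined * (3 * g (.single .up) * g (.single .left) +
        g (.single .right) * g (.single .left) + g (.single .right) * g (.single .up) +
        2 * g (.single .right) ^ 2) +
      g .joined ^ 2 * g .discrete := by
  rw [sum_glues_eq_sum_list _ [
        (.joined, .joined, .discrete), (.joined, .single .up, .single .left),
        (.joined, .single .up, .single .right), (.joined, .single .right, .single .right),
        (.single .left, .joined, .single .up), (.single .left, .joined, .single .right),
        (.single .left, .single .up, .joined), (.single .right, .joined, .single .right)]
      (by decide +kernel)]
  simp only [List.map_cons, List.map_nil, List.sum_cons, List.sum_nil]
  ring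

/-- The block counts add up to 6, hence are 1, 2, 3 in some order or 2, 2, 2. -/
theorem sum_glues_discrete (g : Pattern → A) :
    ∑ q : Corner → Pattern with Glues q .discrete, ∏ k, g (q k) =
      4 * g .joined * g .discrete * (g (.single .up) + g (.single .right) + g (.single .left)) +
      2 * (g (.single .up) ^ 2 * (g (.single .left) + g (.single .right)) +
        g (.single .right) ^ 2 * (g (.single .up) + g (.single .left)) +
        g (.single .left) ^ 2 * (g (.single .right) + g (.single .up))) +
      2 * g (.single .up) * g (.single .right) * g (.single .left) := by
  rw [sum_glues_eq_sum_list _ [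
        (.joined, .single .left, .discrete), (.joined, .single .right, .discrete),
        (.joined, .discrete, .single .left), (.joined, .discrete, .single .right),
        (.single .up, .joined, .discrete), (.single .up, .single .up, .single .left),
        (.single .up, .single .up, .single .right), (.single .up, .single .left, .single .up),
        (.single .up, .single .left, .single .left),
        (.single .up, .single .right, .single .up),
        (.single .up, .single .right, .single .right), (.single .up, .discrete, .joined),
        (.single .left, .single .left, .single .up),
        (.single .left, .single .left, .single .right),
        (.single .left, .single .right, .single .up),
        (.single .left, .single .right, .single .right), (.single .left, .discrete, .joined),
        (.single .right, .joined, .discrete), (.single .right, .single .up, .single .left),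
        (.single .right, .single .up, .single .right),
        (.single .right, .single .left, .single .left),
        (.single .right, .single .left, .single .right), (.discrete, .joined, .single .up),
        (.discrete, .joined, .single .right), (.discrete, .single .up, .joined),
        (.discrete, .single .left, .joined)]
      (by decide +kernel)]
  simp only [List.map_cons, List.map_nil, List.sum_cons, List.sum_nil]
  ring

end Pattern

/-! ### The elementary triangle. -/

namespace Label

/-- The first end of an edge of the elementary triangle. -/
def fst : Label → Corner
  | .a => .left
  | .b => .left
  | .c => .up

/-- The second end of an edge of the elementary triangle. -/
def snd : Label → Corner
  | .a => .up
  | .b => .right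
  | .c => .right

/-- The partition of the corners of the elementary triangle induced by a set of edges. -/
def pattern (F : Finset Label) : Pattern :=
  if 2 ≤ F.card then .joined
  else if .a ∈ F then .single .right
  else if .b ∈ F then .single .up
  else if .c ∈ F then .single .left
  else .discrete

/-- Two corners of the elementary triangle are joined by an edge in `F`. -/
def Linked (F : Finset Label) (i j : Corner) : Prop :=
  ∃ e ∈ F, e.fst = i ∧ e.snd = j ∨ e.fst = j ∧ e.snd = i

instance (F : Finset Label) (i j : Corner) : Decidable (Linked F i j) := by
  unfold Linked; infer_instance

theorem rel_pattern_of_linked : ∀ (F : Finset Label) (i j k : Corner),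
    (pattern F).rel i j = true → Linked F j k → (pattern F).rel i k = true := by
  decide +kernel

/-- With three vertices, paths of length at most two suffice. -/
theorem linked_of_rel_pattern : ∀ (F : Finset Label) (i j : Corner),
    (pattern F).rel i j = true →
      i = j ∨ Linked F i j ∨ ∃ k, Linked F i k ∧ Linked F k j := by
  decide +kernel

theorem rel_pattern_self : ∀ (F : Finset Label) (i : Corner), (pattern F).rel i i = true := by
  decide +kernel

end Label

namespace TriangleGraph

theorem triangle_ends (e : Label) :
    triangle.ends e = s(triangle.outmost e.fst, triangle.outmost e.snd) := by
  cases e <;> rfl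

theorem triangle_adj_iff {F : Finset Label} {i j : Corner} :
    (spanning (G := triangle) F).Adj (triangle.outmost i) (triangle.outmost j) ↔
      i ≠ j ∧ Label.Linked F i j := by
  have hinj {i j} : triangle.outmost i = triangle.outmost j ↔ i = j :=
    ⟨fun h => by_contra fun h' => isInscribed_triangle.outmost_ne h' h, fun h => h ▸ rfl⟩
  refine (SimpleGraph.fromEdgeSet_adj _).trans (and_comm.trans ?_)
  refine and_congr (not_congr hinj) ?_
  exact exists_congr fun e => and_congr Iff.rfl <| (Eq.congr_left (triangle_ends e)).trans <|
    Sym2.eq_iff.trans <| or_congr (and_congr hinj hinj) (and_congr hinj hinj)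

theorem hasPattern_triangle (F : Finset Label) :
    HasPattern (G := triangle) F (Label.pattern F) := by
  intro i j
  have hl {i j} (h : Label.Linked F i j) :
      (spanning (G := triangle) F).Reachable (triangle.outmost i) (triangle.outmost j) := by
    by_cases hij : i = j
    · exact hij ▸ .rfl
    · exact (triangle_adj_iff.2 ⟨hij, h⟩).reachable
  constructor
  · intro h
    replace h := (SimpleGraph.reachable_iff_reflTransGen _ _).1 h
    suffices ∀ v, Relation.ReflTransGen (spanning (G := triangle) F).Adj (triangle.outmost i) v →
        ∃ j, v = triangle.outmost j ∧ (Label.pattern F).rel i j = true by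
      obtain ⟨k, hk, hr⟩ := this _ h
      have : j = k := by_contra fun h' => isInscribed_triangle.outmost_ne h' hk
      exact this ▸ hr
    intro v hv
    induction hv with
    | refl => exact ⟨i, rfl, Label.rel_pattern_self F i⟩
    | @tail v v' _ hadj ih =>
      obtain ⟨k, rfl, hk⟩ := ih
      obtain ⟨_, l, rfl⟩ := v'
      exact ⟨l, rfl, Label.rel_pattern_of_linked F i k l hk (triangle_adj_iff.1 hadj).2⟩
  · intro h
    rcases Label.linked_of_rel_pattern F i j h with rfl | h | ⟨k, h, h'⟩
    · exact .rfl
    · exact hl h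
    · exact (hl h).trans (hl h')

/-- Every vertex is outmost, so covering is automatic; the count excludes only the full triangle. -/
theorem isPatternForest_triangle {F : Finset Label} {p : Pattern} :
    IsPatternForest (G := triangle) F p ↔ Label.pattern F = p ∧ F.card + p.parts = 3 := by
  have hV : Nat.card triangle.verts = 3 := by
    have : Function.Injective (cornerPoint 1) := by
      intro i j h
      simpa [cornerPoint, Pi.single_apply] using congrFun h i
    exact (Nat.card_range_of_injective this).trans (by rw [Nat.card_eq_fintype_card]; rfl)
  constructor
  · intro h
    exact ⟨(hasPattern_triangle F).unique h.hasPattern, hV ▸ h.card⟩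
  · rintro ⟨rfl, h⟩
    refine ⟨?_, hasPattern_triangle F, hV.symm ▸ h⟩
    rintro ⟨_, i, rfl⟩
    exact ⟨i, .rfl⟩

/-- Trades the classical decidability in `genFun` for a computable instance, so that the sums over
the triangle can be evaluated by `decide`. -/
theorem genFun_eq_sum (G : TriangleGraph) {R : Type*} [CommSemiring R] (w : Label → R)
    (P : Finset G.Edge → Prop) [DecidablePred P] :
    G.genFun w P = ∑ F : Finset G.Edge with P F, weight w F :=
  Finset.sum_congr (Finset.filter_congr_decidable _ _ _) fun _ _ => rfl

theorem patternGF_triangle {R : Type*} [CommSemiring R] (w : Label → R) (p : Pattern) :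
    triangle.patternGF w p =
      ∑ F : Finset Label with Label.pattern F = p ∧ F.card + p.parts = 3, ∏ e ∈ F, w e := by
  let P (F : Finset Label) : Prop := Label.pattern F = p ∧ F.card + p.parts = 3
  let hP : DecidablePred P := fun F => inferInstanceAs (Decidable (_ ∧ _))
  refine (triangle.genFun_congr w fun F => isPatternForest_triangle (F := F)).trans ?_
  exact @genFun_eq_sum triangle _ _ w P hP

/-! ### The Sierpiński graphs and the conclusion. -/

theorem isInscribed_schreierGraph (n : ℕ) : (schreierGraph n).IsInscribed := by
  unfold schreierGraph
  induction n - 1 with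
  | zero => exact isInscribed_triangle
  | succ n ih =>
    rw [Function.iterate_succ_apply']
    exact ih.glue

/-- The truncated `n - 1` makes both `schreierGraph 0` and `schreierGraph 1` the triangle, so `n =
0` must be excluded. -/
theorem schreierGraph_succ {n : ℕ} (hn : 1 ≤ n) :
    schreierGraph (n + 1) = (schreierGraph n).glue := by
  obtain ⟨n, rfl⟩ := Nat.exists_eq_add_of_le' hn
  exact Function.iterate_succ_apply' _ _ _

end TriangleGraph

section

variable {A : Type*} [CommSemiring A] (n : ℕ) (a b c : A)

open TriangleGraph

theorem schreierT_eq :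
    schreierT n a b c = (schreierGraph n).patternGF (labelWeight a b c) .joined :=
  have := (isInscribed_schreierGraph n).finite
  treeGF_eq _ _

theorem schreierU_eq :
    schreierU n a b c = (schreierGraph n).patternGF (labelWeight a b c) (.single .up) :=
  have := (isInscribed_schreierGraph n).finite
  twoForestGF_eq _ _ _

theorem schreierR_eq :
    schreierR n a b c = (schreierGraph n).patternGF (labelWeight a b c) (.single .right) :=
  have := (isInscribed_schreierGraph n).finite
  twoForestGF_eq _ _ _

theorem schreierL_eq :
    schreierL n a b c = (schreierGraph n).patternGF (labelWeight a b c) (.single .left) :=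
  have := (isInscribed_schreierGraph n).finite
  twoForestGF_eq _ _ _

theorem schreierQ_eq :
    schreierQ n a b c = (schreierGraph n).patternGF (labelWeight a b c) .discrete :=
  have := (isInscribed_schreierGraph n).finite
  threeForestGF_eq _ _

end

theorem mainTheorem11 {A : Type*} [CommSemiring A] (a b c : A) :
    (∀ n : ℕ, 1 ≤ n →
      schreierT (n + 1) a b c = 2 * schreierT n a b c ^ 2 *
        (schreierU n a b c + schreierR n a b c + schreierL n a b c) ∧
      schreierU (n + 1) a b c =
        schreierT n a b c *
          (3 * schreierL n a b c * schreierR n a b c + schreierU n a b c * schreierR n a b c +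
            schreierU n a b c * schreierL n a b c + 2 * schreierU n a b c ^ 2) +
        schreierT n a b c ^ 2 * schreierQ n a b c ∧
      schreierR (n + 1) a b c =
        schreierT n a b c *
          (3 * schreierU n a b c * schreierL n a b c + schreierR n a b c * schreierL n a b c +
            schreierR n a b c * schreierU n a b c + 2 * schreierR n a b c ^ 2) +
        schreierT n a b c ^ 2 * schreierQ n a b c ∧
      schreierL (n + 1) a b c =
        schreierT n a b c *
          (3 * schreierU n a b c * schreierR n a b c + schreierL n a b c * schreierR n a b c +
            schreierL n a b c * schreierU n a b c + 2 * schreierL n a b c ^ 2) +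
        schreierT n a b c ^ 2 * schreierQ n a b c ∧
      schreierQ (n + 1) a b c =
        4 * schreierT n a b c * schreierQ n a b c * (schreierU n a b c + schreierR n a b c + schreierL n a b c) +
        2 * (schreierU n a b c ^ 2 * (schreierL n a b c + schreierR n a b c) +
            schreierR n a b c ^ 2 * (schreierU n a b c + schreierL n a b c) +
            schreierL n a b c ^ 2 * (schreierR n a b c + schreierU n a b c)) +
        2 * schreierU n a b c * schreierR n a b c * schreierL n a b c) ∧
    schreierT 1 a b c = a * b + a * c + b * c ∧
    schreierU 1 a b c = b ∧ schreierR 1 a b c = a ∧ schreierL 1 a b c = c ∧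
    schreierQ 1 a b c = 1 := by
  simp only [schreierT_eq, schreierU_eq, schreierR_eq, schreierL_eq, schreierQ_eq]
  refine ⟨fun n hn => ?_, ?_⟩
  · simp only [TriangleGraph.schreierGraph_succ hn,
      (TriangleGraph.isInscribed_schreierGraph n).patternGF_glue]
    exact ⟨Pattern.sum_glues_joined _, Pattern.sum_glues_single_up _,
      Pattern.sum_glues_single_right _, Pattern.sum_glues_single_left _,
      Pattern.sum_glues_discrete _⟩
  · have h : schreierGraph 1 = TriangleGraph.triangle := rfl
    have hT : (Finset.univ.filter fun F : Finset Label =>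
        Label.pattern F = .joined ∧ F.card + Pattern.joined.parts = 3) =
          {{.a, .b}, {.a, .c}, {.b, .c}} := by decide +kernel
    have hU : (Finset.univ.filter fun F : Finset Label =>
        Label.pattern F = .single .up ∧ F.card + (Pattern.single .up).parts = 3) =
          {{.b}} := by decide +kernel
    have hR : (Finset.univ.filter fun F : Finset Label =>
        Label.pattern F = .single .right ∧ F.card + (Pattern.single .right).parts = 3) =
          {{.a}} := by decide +kernel
    have hL : (Finset.univ.filter fun F : Finset Label =>
        Label.pattern F = .single .left ∧ F.card + (Pattern.single .left).parts = 3) =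
          {{.c}} := by decide +kernel
    have hQ : (Finset.univ.filter fun F : Finset Label =>
        Label.pattern F = .discrete ∧ F.card + Pattern.discrete.parts = 3) = {∅} := by
      decide +kernel
    simp only [h, TriangleGraph.patternGF_triangle, hT, hU, hR, hL, hQ]
    rw [Finset.sum_insert (by decide), Finset.sum_insert (by decide)]
    simp [labelWeight, add_assoc]
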